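/- Let $(X,\cdot)$ be a finite cycle set, that is, a non-empty finite set with a binary operation such that every map $\sigma_x\colon y\mapsto x\cdot y$ is bijective and $(x\cdot y)\cdot(x\cdot z)=(y\cdot x)\cdot(y\cdot z)$ for all $x,y,z\in X$; as usual, $X$ is assumed non-degenerate, i.e. $x\mapsto x\cdot x$ is bijective. Let $\mathcal{G}(X)=\langle \sigma_x : x\in X\rangle\le \mathrm{Sym}(X)$, and let $\mathrm{Dis}(X)$ be the normal closure of $\{\sigma_x\sigma_y^{-1} : x,y\in X\}$ in $\mathcal{G}(X)$ (the displacement group). Regard $\mathcal{G}(X)$ as a left brace whose multiplication is composition of permutations and whose addition is the unique one for which $\lambda_g(\sigma_x^{-1})=\sigma_{g(x)}^{-1}$ for all $g\in\mathcal{G}(X)$, $x\in X$, where $\lambda_g(h)=-g+gh$. An ideal of this left brace is a normal subgroup of its multiplicative group which is mapped into itself by every $\lambda_g$. A congruence of $X$ is an equivalence relation $\sim$ such that $x\sim x'$ and $y\sim y'$ imply $x\cdot y\sim x'\cdot y'$ and $\sigma_x^{-1}(y)\sim\sigma_{x'}^{-1}(y')$. Suppose that $X$ is irretractable (i.e. $\sigma_x=\sigma_y$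 implies $x=y$) and that $\mathrm{Dis}(X)$ acts regularly (simply transitively) on $X$. Then the congruences of $X$ are in one-to-one correspondence with the ideals of the left brace $\mathcal{G}(X)$ contained in $\mathrm{Dis}(X)$: the map sending such an ideal $I$ to the equivalence relation whose classes are the $I$-orbits on $X$ is a bijection from the set of ideals of $\mathcal{G}(X)$ contained in $\mathrm{Dis}(X)$ onto the set of congruences of $X$. -/

import Mathlib

/-- A left quasigroup: a binary operation all of whose left multiplications are bijective.
(Non-emptiness of the underlying set is a separate hypothesis `[Nonempty X]`.) -/
class LeftQuasigroup (X : Type*) where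
  /-- the operation `x · y` -/
  op : X → X → X
  bijective_op : ∀ x, Function.Bijective (op x)

/-- A cycle set: a left quasigroup with `(x·y)·(x·z) = (y·x)·(y·z)`. -/
class CycleSet (X : Type*) extends LeftQuasigroup X where
  cycle_eq : ∀ x y z, op (op x y) (op x z) = op (op y x) (op y z)

/-- A cycle set is non-degenerate if the squaring map `x ↦ x·x` is bijective. -/
class CycleSet.IsNondegenerate (X : Type*) [CycleSet X] : Prop where
  bijective_sq : Function.Bijective (fun x : X => LeftQuasigroup.op x x)

/-- A left brace: an abelian group `(B, +)` and a group `(B, *)` on the same set with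
`x * (y + z) + x = x * y + x * z`. -/
class IsLeftBrace (B : Type*) [AddCommGroup B] [Group B] : Prop where
  brace_eq : ∀ x y z : B, x * (y + z) + x = x * y + x * z

namespace IsLeftBrace

variable {B : Type*} [AddCommGroup B] [Group B]

/-- The map `λ_x(y) = -x + x * y`. -/
def lam (x y : B) : B := -x + x * y

/-- An ideal of a left brace: a normal subgroup of the multiplicative group which is mapped into
itself by all the maps `λ_x`. -/
structure IsIdeal (I : Subgroup B) : Prop where
  normal : I.Normal
  lam_mem : ∀ x : B, ∀ y ∈ I, lam x y ∈ I

end IsLeftBrace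

namespace LeftQuasigroup

section

variable (X : Type*) [LeftQuasigroup X]

variable {X} in
/-- Left multiplication `σ_x : y ↦ x · y`, as a permutation. -/
noncomputable def sigma (x : X) : Equiv.Perm X := Equiv.ofBijective (op x) (bijective_op x)

/-- The permutation group `𝒢(X)`, generated by all `σ_x`. -/
def permGroup : Subgroup (Equiv.Perm X) := Subgroup.closure (Set.range sigma)

variable {X} in
/-- `σ_x` as an element of `𝒢(X)`. -/
noncomputable def sig (x : X) : permGroup X := ⟨sigma x, Subgroup.subset_closure ⟨x, rfl⟩⟩

/-- The displacement group `Dis(X)`: the normal closure in `𝒢(X)` of all `σ_x σ_y⁻¹`. -/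
def dis : Subgroup (permGroup X) :=
  Subgroup.normalClosure {g | ∃ x y : X, g = sig x * (sig y)⁻¹}

/-- `X` has regular displacement group: `Dis(X)` acts simply transitively on `X`. -/
def HasRegularDis : Prop := ∀ x y : X, ∃! g : dis X, g • x = y

/-- `X` is irretractable: `σ_x = σ_y` only if `x = y`. -/
def IsIrretractable : Prop := Function.Injective (sigma : X → Equiv.Perm X)

variable {X} in
/-- A congruence: an equivalence relation compatible with `x · y` and `σ_x⁻¹(y)`. -/
def IsCongruence (r : Setoid X) : Prop :=
  ∀ x x' y y' : X, r x x' → r y y' →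
    r (op x y) (op x' y') ∧ r ((sigma x).symm y) ((sigma x').symm y')

end

end LeftQuasigroup

/-! The left brace structure of `𝒢(X)` for a non-degenerate cycle set `X`. The multiplication is
composition. The addition is the only one making `𝒢(X)` a left brace with
`λ_g(σ_x⁻¹) = σ_{g(x)}⁻¹`, i.e. `g + σ_x⁻¹ = g σ_{g⁻¹(x)}⁻¹`. To construct it, note that the maps
`T_x : g ↦ g σ_{g⁻¹(x)}⁻¹` are commuting permutations of `𝒢(X)` which generate a regular
group `A`; the bijection `A → 𝒢(X)`, `a ↦ a(1)` carries the group structure of `A` to `𝒢(X)`. -/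

namespace CycleSet

open LeftQuasigroup

variable {X : Type*} [CycleSet X]

theorem sig_smul (x y : X) : sig x • y = op x y := rfl

theorem sig_mul_sig (x y : X) : sig (op x y) * sig x = sig (op y x) * sig y :=
  Subtype.ext (Equiv.ext fun z => cycle_eq x y z)

variable [IsNondegenerate X]

/-- The squaring map as a permutation. -/
noncomputable def sq : Equiv.Perm X :=
  Equiv.ofBijective (fun x : X => op x x) IsNondegenerate.bijective_sq

theorem sq_apply (x : X) : sq x = sig x • x := rfl

/-- The permutation `T_x : g ↦ g σ_{g⁻¹(x)}⁻¹` of `𝒢(X)`. -/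
noncomputable def trans (x : X) : Equiv.Perm (permGroup X) where
  toFun g := g * (sig (g⁻¹ • x))⁻¹
  invFun k := k * sig (sq.symm (k⁻¹ • x))
  left_inv g := by
    have h : (g * (sig (g⁻¹ • x))⁻¹)⁻¹ • x = sq (g⁻¹ • x) := by
      rw [mul_inv_rev, inv_inv, mul_smul, sq_apply]
    simp only [h, Equiv.symm_apply_apply, inv_mul_cancel_right]
  right_inv k := by
    have h : (k * sig (sq.symm (k⁻¹ • x)))⁻¹ • x = sq.symm (k⁻¹ • x) := by
      rw [mul_inv_rev, mul_smul, inv_smul_eq_iff, ← sq_apply, Equiv.apply_symm_apply]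
    simp only [h, mul_inv_cancel_right]

theorem trans_apply (x : X) (g : permGroup X) : trans x g = g * (sig (g⁻¹ • x))⁻¹ := rfl

theorem trans_symm_apply (x : X) (g : permGroup X) :
    (trans x)⁻¹ g = g * sig (sq.symm (g⁻¹ • x)) := rfl

theorem trans_comm (x y : X) : trans x * trans y = trans y * trans x := by
  ext1 g
  simp only [Equiv.Perm.mul_apply, trans_apply, mul_inv_rev, inv_inv, mul_smul, sig_smul,
    mul_assoc]
  rw [← mul_inv_rev, ← mul_inv_rev, sig_mul_sig]

variable (X) in
/-- The group `A` of permutations of `𝒢(X)` generated by the `T_x`. -/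
def transGroup : Subgroup (Equiv.Perm (permGroup X)) := Subgroup.closure (Set.range trans)

theorem transGroup_comm {a b : Equiv.Perm (permGroup X)} (ha : a ∈ transGroup X)
    (hb : b ∈ transGroup X) : a * b = b * a := by
  have hle : transGroup X ≤ Subgroup.centralizer (Set.range trans) := by
    refine (Subgroup.closure_le _).2 ?_
    rintro _ ⟨x, rfl⟩
    refine Subgroup.mem_centralizer_iff.2 ?_
    rintro _ ⟨y, rfl⟩
    exact trans_comm y x
  have hle' : transGroup X ≤ Subgroup.centralizer (transGroup X) := by
    refine (Subgroup.closure_le _).2 ?_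
    rintro _ ⟨x, rfl⟩
    refine Subgroup.mem_centralizer_iff.2 fun c hc => ?_
    exact (Subgroup.mem_centralizer_iff.1 (hle hc) _ ⟨x, rfl⟩).symm
  exact Subgroup.mem_centralizer_iff.1 (hle' hb) a ha

theorem exists_transGroup (g : permGroup X) : ∃ a ∈ transGroup X, a 1 = g := by
  obtain ⟨g, hg⟩ := g
  induction hg using Subgroup.closure_induction_right with
  | one => exact ⟨1, one_mem _, rfl⟩
  | mul_right g hg s hs ih =>
    obtain ⟨y, rfl⟩ := hs
    obtain ⟨a, ha, hag⟩ := ih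
    let g' : permGroup X := ⟨g, hg⟩
    refine ⟨(trans (g' • sq y))⁻¹ * a,
      mul_mem (inv_mem (Subgroup.subset_closure ⟨_, rfl⟩)) ha, ?_⟩
    rw [Equiv.Perm.mul_apply, hag, trans_symm_apply]
    change g' * sig (sq.symm (g'⁻¹ • g' • sq y)) = g' * sig y
    rw [inv_smul_smul, Equiv.symm_apply_apply]
  | mul_inv_cancel g hg s hs ih =>
    obtain ⟨y, rfl⟩ := hs
    obtain ⟨a, ha, hag⟩ := ih
    let g' : permGroup X := ⟨g, hg⟩
    refine ⟨trans (g' • y) * a, mul_mem (Subgroup.subset_closure ⟨_, rfl⟩) ha, ?_⟩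
    rw [Equiv.Perm.mul_apply, hag, trans_apply]
    change g' * (sig (g'⁻¹ • g' • y))⁻¹ = g' * (sig y)⁻¹
    rw [inv_smul_smul]

theorem transGroup_ext {a b : Equiv.Perm (permGroup X)} (ha : a ∈ transGroup X)
    (hb : b ∈ transGroup X) {g : permGroup X} (h : a g = b g) : a = b := by
  ext1 k
  obtain ⟨c, hc, rfl⟩ := exists_transGroup g
  obtain ⟨d, hd, rfl⟩ := exists_transGroup k
  have hdc : d 1 = (d * c⁻¹) (c 1) := by simp
  have hm : d * c⁻¹ ∈ transGroup X := mul_mem hd (inv_mem hc)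
  have key : ∀ e ∈ transGroup X, e (d 1) = (d * c⁻¹) (e (c 1)) := fun e he => by
    rw [hdc, ← Equiv.Perm.mul_apply, transGroup_comm he hm, Equiv.Perm.mul_apply]
  rw [key a ha, key b hb, h]

variable (X) in
/-- The bijection `A → 𝒢(X)`, `a ↦ a(1)`. -/
noncomputable def transEquiv : transGroup X ≃ permGroup X :=
  Equiv.ofBijective (fun a => a.1 1)
    ⟨fun a b h => Subtype.ext (transGroup_ext a.2 b.2 h), fun g =>
      let ⟨a, ha, h⟩ := exists_transGroup g
      ⟨⟨a, ha⟩, h⟩⟩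

noncomputable instance : CommGroup (transGroup X) :=
  { (inferInstance : Group (transGroup X)) with
    mul_comm := fun a b => Subtype.ext (transGroup_comm a.2 b.2) }

/-- The additive group of the left brace `𝒢(X)`. -/
noncomputable instance instAddCommGroupPermGroup : AddCommGroup (permGroup X) :=
  ((transEquiv X).symm.trans Additive.ofMul).addCommGroup

/-- Addition in `𝒢(X)`: `a(1) + k = a(k)` for `a` in `A`. -/
theorem apply_one_add {a : Equiv.Perm (permGroup X)} (ha : a ∈ transGroup X)
    (k : permGroup X) : a 1 + k = a k := by
  obtain ⟨b, rfl⟩ := (transEquiv X).surjective k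
  change transEquiv X ((transEquiv X).symm (transEquiv X ⟨a, ha⟩) *
    (transEquiv X).symm (transEquiv X b)) = _
  rw [Equiv.symm_apply_apply, Equiv.symm_apply_apply]
  rfl

theorem trans_eq_add (x : X) (g : permGroup X) : trans x g = (sig x)⁻¹ + g := by
  have hx : trans x ∈ transGroup X := Subgroup.subset_closure ⟨x, rfl⟩
  rw [← apply_one_add hx g, trans_apply]
  simp

/-- The formula for addition of a generator, `g + σ_x⁻¹ = g σ_{g⁻¹(x)}⁻¹`. -/
theorem add_sig_inv (g : permGroup X) (x : X) :
    g + (sig x)⁻¹ = g * (sig (g⁻¹ • x))⁻¹ := by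
  rw [add_comm, ← trans_eq_add, trans_apply]

theorem conj_trans (g : permGroup X) (x : X) :
    MulAut.conj (Equiv.mulLeft g) (trans x) = trans (g • x) := by
  rw [MulAut.conj_apply, mul_inv_eq_iff_eq_mul]
  ext1 h
  simp only [Equiv.Perm.mul_apply, Equiv.coe_mulLeft, trans_apply, mul_inv_rev, mul_smul,
    inv_smul_smul, mul_assoc]

theorem conj_mem (g : permGroup X) {a : Equiv.Perm (permGroup X)} (ha : a ∈ transGroup X) :
    MulAut.conj (Equiv.mulLeft g) a ∈ transGroup X := by
  have hle : transGroup X ≤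
      (transGroup X).comap (MulAut.conj (Equiv.mulLeft g)).toMonoidHom := by
    refine (Subgroup.closure_le _).2 ?_
    rintro _ ⟨x, rfl⟩
    change MulAut.conj (Equiv.mulLeft g) (trans x) ∈ transGroup X
    rw [conj_trans]
    exact Subgroup.subset_closure ⟨_, rfl⟩
  exact hle ha

/-- `𝒢(X)` is a left brace. -/
instance instIsLeftBracePermGroup : IsLeftBrace (permGroup X) where
  brace_eq g h k := by
    obtain ⟨a, ha, rfl⟩ := exists_transGroup h
    have hb := conj_mem g ha
    have key : ∀ m : permGroup X, MulAut.conj (Equiv.mulLeft g) a (g * m) = g * a m := by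
      intro m
      simp [MulAut.conj_apply]
    have h1 := apply_one_add hb (g * 1)
    have h2 := apply_one_add hb (g * k)
    rw [key] at h1 h2
    rw [apply_one_add ha, ← h2, ← h1, mul_one]
    abel

/-- The characterising property `λ_g(σ_x⁻¹) = σ_{g(x)}⁻¹` of the left brace `𝒢(X)`. -/
theorem lam_sig_inv (g : permGroup X) (x : X) :
    IsLeftBrace.lam g (sig x)⁻¹ = (sig (g • x))⁻¹ := by
  rw [IsLeftBrace.lam, neg_add_eq_iff_eq_add, add_sig_inv, inv_smul_smul]

end CycleSet

/-! An ideal `I` acts trivially by `λ` modulo itself (`inv_mul_lam_mem`), so `σ_{h(x)}` and `σ_x`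
agree modulo `I` for `h ∈ I`; with normality this makes the `I`-orbits a congruence. By regularity,
a subgroup of `Dis(X)` is determined by its orbits, whence injectivity.

For surjectivity, attach to a congruence `r` the group `disKer r`. Counting shows that a
displacement preserving a single class is some `σ_y⁻¹ σ_z` with `y ~ z`, and these preserve every
class (`exists_eq_sig_inv_mul_sig`, `sig_inv_mul_sig_smul`). So `disKer r` has the classes as
orbits. Its elements are also differences `σ_y⁻¹ - σ_v⁻¹` with `y ~ v`, a form that `λ_g` respects,
so it is an ideal. -/

/-! ### The `λ`-action and ideals of a left brace -/

namespace IsLeftBrace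

variable {B : Type*} [AddCommGroup B] [Group B]

theorem add_lam (a b : B) : a + lam a b = a * b := by
  rw [lam, add_neg_cancel_left]

variable [IsLeftBrace B]

theorem lam_add (g a b : B) : lam g (a + b) = lam g a + lam g b := by
  have h : g * (a + b) = g * a + g * b - g := eq_sub_of_add_eq (brace_eq g a b)
  rw [lam, lam, lam, h]
  abel

theorem lam_neg (g a : B) : lam g (-a) = -lam g a :=
  map_neg (AddMonoidHom.mk' (lam g) (lam_add g)) a

theorem lam_mul (g h a : B) : lam (g * h) a = lam g (lam h a) := by
  rw [lam, show lam h a = -h + h * a from rfl, lam_add, lam_neg, lam, lam, mul_assoc]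
  abel

theorem one_eq_zero : (1 : B) = 0 := by
  simpa using brace_eq (1 : B) 0 0

theorem one_lam (a : B) : lam 1 a = a := by
  rw [lam, one_mul, one_eq_zero, neg_zero, zero_add]

theorem lam_inv_self (a : B) : lam a a⁻¹ = -a := by
  rw [lam, mul_inv_cancel, one_eq_zero, add_zero]

theorem mul_lam_inv (a b : B) : a * lam a⁻¹ b = a + b := by
  rw [← add_lam, ← lam_mul, mul_inv_cancel, one_lam]

namespace IsIdeal

variable {I : Subgroup B}

theorem add_mem (hI : IsIdeal I) {a b : B} (ha : a ∈ I) (hb : b ∈ I) : a + b ∈ I := by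
  rw [← mul_lam_inv]
  exact I.mul_mem ha (hI.lam_mem _ _ hb)

theorem neg_mem (hI : IsIdeal I) {a : B} (ha : a ∈ I) : -a ∈ I := by
  rw [← lam_inv_self]
  exact hI.lam_mem _ _ (I.inv_mem ha)

/-- Elements of an ideal act trivially by `λ` modulo the ideal. -/
theorem inv_mul_lam_mem (hI : IsIdeal I) {h : B} (hh : h ∈ I) (g : B) : g⁻¹ * lam h g ∈ I := by
  have h1 : -h + lam g (g⁻¹ * h * g) ∈ I := by
    refine hI.add_mem (hI.neg_mem hh) (hI.lam_mem _ _ ?_)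
    simpa using hI.normal.conj_mem h hh g⁻¹
  -- Both sides equal `-g - h + h * g`.
  have h2 : lam g (g⁻¹ * lam h g) = -h + lam g (g⁻¹ * h * g) := by
    have e : g * (g⁻¹ * h * g) = h * g := by group
    rw [lam, lam, lam, mul_inv_cancel_left, e]
    abel
  have h3 := hI.lam_mem g⁻¹ _ (h2 ▸ h1)
  rwa [← lam_mul, inv_mul_cancel, one_lam] at h3

end IsIdeal

end IsLeftBrace

/-! ### Congruences and displacements -/

namespace LeftQuasigroup

variable {X : Type*} [LeftQuasigroup X]

theorem sig_injective (hirr : IsIrretractable X) : Function.Injective (sig : X → permGroup X) :=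
  fun _ _ h => hirr (congrArg Subtype.val h)

theorem sig_inv_mul_sig_mem_dis (x y : X) : (sig x)⁻¹ * sig y ∈ dis X := by
  have h : sig y * (sig x)⁻¹ ∈ dis X := Subgroup.subset_normalClosure ⟨y, x, rfl⟩
  have := Subgroup.normalClosure_normal.conj_mem _ h (sig x)⁻¹
  rwa [mul_assoc, inv_inv, inv_mul_cancel_right] at this

theorem HasRegularDis.exists_smul_eq (hreg : HasRegularDis X) (x y : X) :
    ∃ g ∈ dis X, g • x = y := by
  obtain ⟨g, hg, -⟩ := hreg x y
  exact ⟨g, g.2, hg⟩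

theorem HasRegularDis.eq_of_smul_eq (hreg : HasRegularDis X) {g h : permGroup X}
    (hg : g ∈ dis X) (hh : h ∈ dis X) {x : X} (e : g • x = h • x) : g = h :=
  congrArg Subtype.val ((hreg x (h • x)).unique (y₁ := ⟨g, hg⟩) (y₂ := ⟨h, hh⟩) e rfl)

theorem IsCongruence.smul_iff {r : Setoid X} (hr : IsCongruence r) (g : permGroup X) {x y : X} :
    r (g • x) (g • y) ↔ r x y := by
  obtain ⟨g, hg⟩ := g
  change r (g x) (g y) ↔ r x y
  induction hg using Subgroup.closure_induction generalizing x y with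
  | mem g hg =>
    obtain ⟨z, rfl⟩ := hg
    refine ⟨fun h => ?_, fun h => (hr z z x y (r.refl z) h).1⟩
    simpa using (hr z z _ _ (r.refl z) h).2
  | one => rfl
  | mul a b _ _ iha ihb => exact iha.trans ihb
  | inv a _ iha =>
    rw [← iha]
    exact iff_of_eq (congrArg₂ r (a.apply_symm_apply x) (a.apply_symm_apply y))

theorem IsCongruence.sig_inv_mul_sig_smul {r : Setoid X} (hr : IsCongruence r) {y z : X}
    (h : r y z) (x : X) : r (((sig y)⁻¹ * sig z) • x) x := by
  have := (hr y z (sig z • x) (sig z • x) h (r.refl _)).2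
  change r ((sig y)⁻¹ • sig z • x) ((sig z)⁻¹ • sig z • x) at this
  rwa [inv_smul_smul, ← mul_smul] at this

/-- The displacements preserving one class of a congruence are the `σ_y⁻¹ σ_z` with `y` in the
class of any given `z`. -/
theorem IsCongruence.exists_eq_sig_inv_mul_sig [Finite X] (hirr : IsIrretractable X)
    (hreg : HasRegularDis X) {r : Setoid X} (hr : IsCongruence r) {d : permGroup X}
    (hd : d ∈ dis X) {x : X} (hx : r (d • x) x) (z : X) :
    ∃ y, r y z ∧ d = (sig y)⁻¹ * sig z := by
  obtain ⟨e, -, rfl⟩ := hreg.exists_smul_eq z x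
  have hmaps (y : {y // r y z}) : r (e⁻¹ • ((sig y.1)⁻¹ * sig z) • e • z) z := by
    rw [← hr.smul_iff e, smul_inv_smul]
    exact hr.sig_inv_mul_sig_smul y.2 _
  -- A self-map of the class of `z`. It is injective by regularity and irretractability, hence onto
  -- by finiteness. Conjugating by `e` carries the base point `x = e • z` back to `z`.
  let f (y : {y // r y z}) : {y // r y z} := ⟨_, hmaps y⟩
  have hinj : Function.Injective f := fun y y' h => by
    have h := MulAction.injective e⁻¹ (congrArg Subtype.val h)
    have h := hreg.eq_of_smul_eq (sig_inv_mul_sig_mem_dis _ _) (sig_inv_mul_sig_mem_dis _ _) h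
    exact Subtype.ext (sig_injective hirr (inv_injective (mul_right_cancel h)))
  have hdz : r (e⁻¹ • d • e • z) z := by
    rwa [← hr.smul_iff e, smul_inv_smul]
  obtain ⟨y, hy⟩ := Finite.surjective_of_injective hinj ⟨_, hdz⟩
  have h := MulAction.injective e⁻¹ (congrArg Subtype.val hy)
  exact ⟨y, y.2, hreg.eq_of_smul_eq hd (sig_inv_mul_sig_mem_dis _ _) h.symm⟩

/-- The displacements preserving every class of an equivalence relation. -/
def disKer (r : Setoid X) : Subgroup (permGroup X) where
  carrier := {g | g ∈ dis X ∧ ∀ x, r (g • x) x}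
  one_mem' := ⟨one_mem _, fun x => by rw [one_smul]⟩
  mul_mem' {a b} ha hb := ⟨mul_mem ha.1 hb.1, fun x => by
    rw [mul_smul]
    exact r.trans (ha.2 _) (hb.2 x)⟩
  inv_mem' {a} ha := ⟨inv_mem ha.1, fun x => by
    simpa using r.symm (ha.2 (a⁻¹ • x))⟩

theorem IsCongruence.normal_disKer {r : Setoid X} (hr : IsCongruence r) : (disKer r).Normal where
  conj_mem a ha g := by
    refine ⟨Subgroup.normalClosure_normal.conj_mem a ha.1 g, fun x => ?_⟩
    rw [← hr.smul_iff g⁻¹, mul_assoc, mul_smul, inv_smul_smul, mul_smul]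
    exact ha.2 _

theorem IsCongruence.sig_inv_mul_sig_mem_disKer {r : Setoid X} (hr : IsCongruence r) {y z : X}
    (h : r y z) : (sig y)⁻¹ * sig z ∈ disKer r :=
  ⟨sig_inv_mul_sig_mem_dis y z, hr.sig_inv_mul_sig_smul h⟩

/-- The displacement taking `y` to an equivalent `x` preserves the class of `y`, so it has the form
`σ_w⁻¹ σ_y` with `w ~ y` and therefore preserves all classes. -/
theorem IsCongruence.orbitRel_disKer [Finite X] (hirr : IsIrretractable X)
    (hreg : HasRegularDis X) {r : Setoid X} (hr : IsCongruence r) :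
    MulAction.orbitRel (disKer r) X = r := by
  ext x y
  rw [MulAction.orbitRel_apply]
  constructor
  · rintro ⟨g, rfl⟩
    exact g.2.2 y
  · intro h
    obtain ⟨d, hd, rfl⟩ := hreg.exists_smul_eq y x
    obtain ⟨w, hw, rfl⟩ := hr.exists_eq_sig_inv_mul_sig hirr hreg hd h y
    exact ⟨⟨_, hr.sig_inv_mul_sig_mem_disKer hw⟩, rfl⟩

/-- A displacement is determined by the image of one point, so `I` can be read off from its orbits.
-/
theorem HasRegularDis.mem_iff_orbitRel [Nonempty X] (hreg : HasRegularDis X)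
    {I : Subgroup (permGroup X)} (hI : I ≤ dis X) {g : permGroup X} :
    g ∈ I ↔ g ∈ dis X ∧ ∀ x, MulAction.orbitRel I X (g • x) x := by
  refine ⟨fun hg => ⟨hI hg, fun x => ⟨⟨g, hg⟩, rfl⟩⟩, fun ⟨hg, h⟩ => ?_⟩
  obtain ⟨x⟩ := ‹Nonempty X›
  obtain ⟨a, ha⟩ := h x
  rw [hreg.eq_of_smul_eq hg (hI a.2) (x := x) ha.symm]
  exact a.2

end LeftQuasigroup

/-! ### The correspondence for cycle sets -/

namespace CycleSet

open LeftQuasigroup IsLeftBrace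

variable {X : Type*} [CycleSet X] [IsNondegenerate X]

/-- If `w·w = x·y`, then `σ_w⁻¹(x·y) = w`, so adding `σ_y⁻¹` to `σ_x⁻¹ σ_w` cancels the factor
`σ_w`. -/
theorem sig_inv_sub_sig_inv (x y : X) :
    (sig x)⁻¹ - (sig y)⁻¹ = (sig x)⁻¹ * sig (sq.symm (op x y)) := by
  rw [sub_eq_iff_eq_add, add_sig_inv, mul_inv_rev, inv_inv, mul_smul, sig_smul, mul_assoc]
  have h : sq.symm (op x y) = (sig (sq.symm (op x y)))⁻¹ • op x y := by
    rw [eq_inv_smul_iff, ← sq_apply, Equiv.apply_symm_apply]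
  rw [← h, mul_inv_cancel, mul_one]

/-- A finite congruence quotient is non-degenerate. -/
theorem rel_of_rel_sq [Finite X] {r : Setoid X} (hr : IsCongruence r) {x y : X}
    (h : r (sq x) (sq y)) : r x y := by
  let f : Quotient r → Quotient r := Quotient.map sq fun a b hab => (hr a b a b hab hab).1
  have hs : Function.Surjective f := by
    rintro ⟨a⟩
    exact ⟨⟦sq.symm a⟧, congrArg (Quotient.mk r) (sq.apply_symm_apply a)⟩
  have hf : f ⟦x⟧ = f ⟦y⟧ := Quotient.sound h
  exact Quotient.exact (Finite.injective_iff_surjective.2 hs hf)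

theorem sq_symm_op_rel [Finite X] {r : Setoid X} (hr : IsCongruence r) {x y : X} (h : r x y) :
    r x (sq.symm (op x y)) := by
  refine rel_of_rel_sq hr ?_
  rw [Equiv.apply_symm_apply]
  exact (hr x x x y (r.refl x) h).1

theorem isIdeal_disKer [Finite X] [Nonempty X] (hirr : IsIrretractable X)
    (hreg : HasRegularDis X) {r : Setoid X} (hr : IsCongruence r) : IsIdeal (disKer r) where
  normal := hr.normal_disKer
  lam_mem g d hd := by
    obtain ⟨z⟩ := ‹Nonempty X›
    obtain ⟨y, hyz, rfl⟩ := hr.exists_eq_sig_inv_mul_sig hirr hreg hd.1 (hd.2 z) z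
    -- With `y·v = z·z`, the product `σ_y⁻¹ σ_z` becomes the difference `σ_y⁻¹ - σ_v⁻¹`, to which
    -- the additive map `λ_g` applies termwise.
    obtain ⟨v, hv⟩ := bijective_op y |>.2 (sq z)
    have hyv : r y v := by
      rw [← hr.smul_iff (sig y), sig_smul, sig_smul, hv]
      exact (hr y z y z hyz hyz).1
    rw [← sq.symm_apply_apply z, ← hv, ← sig_inv_sub_sig_inv, sub_eq_add_neg, lam_add, lam_neg,
      lam_sig_inv, lam_sig_inv, ← sub_eq_add_neg, sig_inv_sub_sig_inv]
    exact hr.sig_inv_mul_sig_mem_disKer (sq_symm_op_rel hr ((hr.smul_iff g).2 hyv))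

theorem isCongruence_orbitRel {I : Subgroup (permGroup X)} (hI : IsIdeal I) :
    IsCongruence (MulAction.orbitRel I X) := by
  have hn := hI.normal
  rintro _ x _ y ⟨⟨h, hh⟩, rfl⟩ ⟨⟨k, hk⟩, rfl⟩
  -- This yields `σ_x σ_{h(x)}⁻¹ ∈ I`.
  have hi := hI.inv_mul_lam_mem hh (sig x)⁻¹
  rw [lam_sig_inv, inv_inv] at hi
  constructor
  · have hm := mul_mem (inv_mem hi) (hn.conj_mem k hk (sig x))
    refine ⟨⟨sig (h • x) * k * (sig x)⁻¹, ?_⟩, ?_⟩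
    · convert hm using 1
      group
    · change (sig (h • x) * k * (sig x)⁻¹) • sig x • y = sig (h • x) • k • y
      rw [mul_smul, inv_smul_smul, mul_smul]
  · have hm := hn.conj_mem _ (mul_mem hi hk) (sig x)⁻¹
    refine ⟨⟨(sig (h • x))⁻¹ * k * sig x, ?_⟩, ?_⟩
    · convert hm using 1
      group
    · change ((sig (h • x))⁻¹ * k * sig x) • (sig x)⁻¹ • y = (sig (h • x))⁻¹ • k • y
      rw [mul_smul, smul_inv_smul, mul_smul]

end CycleSet

/-- Let `X` be a finite irretractable (non-degenerate) cycle set with regular displacement group.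
Sending an ideal `I` of the left brace `𝒢(X)` contained in `Dis(X)` to the relation of lying in
the same `I`-orbit is a bijection onto the congruences of `X`. -/
theorem mainTheorem4 (X : Type*) [CycleSet X] [CycleSet.IsNondegenerate X] [Nonempty X] [Finite X]
    (hirr : LeftQuasigroup.IsIrretractable X) (hreg : LeftQuasigroup.HasRegularDis X) :
    Set.BijOn (fun I : Subgroup (LeftQuasigroup.permGroup X) => MulAction.orbitRel I X)
      {I | IsLeftBrace.IsIdeal I ∧ I ≤ LeftQuasigroup.dis X}
      {r | LeftQuasigroup.IsCongruence r} := by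
  refine ⟨fun I hI => CycleSet.isCongruence_orbitRel hI.1, fun I hI J hJ h => ?_, fun r hr => ?_⟩
  · ext g
    rw [hreg.mem_iff_orbitRel hI.2, hreg.mem_iff_orbitRel hJ.2]
    have h : MulAction.orbitRel I X = MulAction.orbitRel J X := h
    rw [h]
  · exact ⟨LeftQuasigroup.disKer r, ⟨CycleSet.isIdeal_disKer hirr hreg hr, fun g hg => hg.1⟩,
      LeftQuasigroup.IsCongruence.orbitRel_disKer hirr hreg hr⟩
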